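/- Let $G$ be a finite simple connected unicyclic graph, i.e. a finite simple connected graph with exactly one cycle, and let $C(G)$ denote this cycle, regarded as a graph in its own right. Call two vertices $u,v$ of a connected graph $H$ doubly resolved by vertices $x,y$ of $H$ if $$d_H(v,x)-d_H(u,x)\neq d_H(v,y)-d_H(u,y),$$ where $d_H$ is the graph distance in $H$. A set $W\subseteq V(H)$ is a doubly resolving set for $H$ if every two distinct vertices of $H$ are doubly resolved by some two vertices of $W$, and a doubly basis of $H$ is a doubly resolving set for $H$ of minimum cardinality. Let $W\subseteq V(C(G))$ be a doubly resolving set for the graph $C(G)$ such that every vertex of $W$ has degree at least $3$ in $G$. Then the set $L(G)$ of leaves of $G$ (the vertices of degree $1$ in $G$) is a doubly basis of $G$. -/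

import Mathlib

namespace SimpleGraph

/-- A pair of vertices `u, v` of `G` is doubly resolved by `x, y` if
`d(v, x) - d(u, x) ≠ d(v, y) - d(u, y)` (differences taken in the integers). -/
def DoublyResolves {V : Type*} (G : SimpleGraph V) (x y u v : V) : Prop :=
  (G.dist v x : ℤ) - (G.dist u x : ℤ) ≠ (G.dist v y : ℤ) - (G.dist u y : ℤ)

/-- `W` is a doubly resolving set for `G` if every two distinct vertices of `G` are doubly
resolved by some two vertices of `W`. -/
def IsDoublyResolvingSet {V : Type*} (G : SimpleGraph V) (W : Set V) : Prop :=
  ∀ u v : V, u ≠ v → ∃ x ∈ W, ∃ y ∈ W, G.DoublyResolves x y u v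

/-- A doubly basis of `G`: a doubly resolving set of minimum cardinality. -/
def IsDoublyBasis {V : Type*} (G : SimpleGraph V) (B : Set V) : Prop :=
  G.IsDoublyResolvingSet B ∧ ∀ W : Set V, G.IsDoublyResolvingSet W → B.encard ≤ W.encard

/-- A subgraph of `G` is a cycle if it is the subgraph traced out by a cyclic walk
(independently of base point and orientation of the walk). -/
def Subgraph.IsCycleSubgraph {V : Type*} {G : SimpleGraph V} (C : G.Subgraph) : Prop :=
  ∃ (u : V) (w : G.Walk u u), w.IsCycle ∧ w.toSubgraph = C

/-- A graph is unicyclic if it has exactly one cycle. -/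
def IsUnicyclic {V : Type*} (G : SimpleGraph V) : Prop :=
  ∃! C : G.Subgraph, C.IsCycleSubgraph

/-- The unique cycle `C(G)` of a unicyclic graph `G`. -/
noncomputable def IsUnicyclic.cycle {V : Type*} {G : SimpleGraph V} (h : G.IsUnicyclic) :
    G.Subgraph :=
  h.choose

/-- The set `L(G)` of leaves of `G`, i.e. of vertices of degree one. -/
def leafSet {V : Type*} (G : SimpleGraph V) [G.LocallyFinite] : Set V :=
  {v | G.degree v = 1}

end SimpleGraph

/-! Minimality: a leaf and its neighbour can be doubly resolved only using that leaf, so every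
doubly resolving set contains `leafSet`. Resolution: edges off the cycle are bridges, so every
vertex reaches the cycle through one gate. The difference of distances from `v` and `u` to a
landmark lies between `-d(u,v)` and `d(u,v)`, and a leaf beyond `u` or beyond `v` attains an
extreme. When neither extreme can be forced this way, a landmark `w` in `W` is traded for a leaf
hanging beyond `w`, which exists since `w` has an edge off the cycle. `isDoublyResolvingSet_leafSet`
combines these cases. -/

namespace SimpleGraph

variable {V : Type*} {G : SimpleGraph V}

/-! ### Distances across a bridge -/

/-- `S` is joined to its complement by the single edge `p q`, with `q ∈ S`. -/
structure IsEdgeCut (G : SimpleGraph V) (S : Set V) (p q : V) : Prop where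
  adj : G.Adj p q
  left_notMem : p ∉ S
  right_mem : q ∈ S
  eq_of_adj : ∀ ⦃z y⦄, z ∉ S → y ∈ S → G.Adj z y → z = p ∧ y = q

theorem IsBridge.exists_isEdgeCut {p q : V} (hadj : G.Adj p q) (h : G.IsBridge s(p, q)) :
    ∃ S, G.IsEdgeCut S p q := by
  have hp : ¬ (G.deleteEdges {s(p, q)}).Reachable p q := by
    rw [isBridge_iff] at h
    tauto
  refine ⟨{x | (G.deleteEdges {s(p, q)}).Reachable q x}, hadj, fun h' => hp h'.symm,
    Reachable.refl _, fun z y hz hy hzy => ?_⟩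
  by_cases he : s(z, y) = s(p, q)
  · rcases Sym2.eq_iff.1 he with h | ⟨rfl, rfl⟩
    · exact h
    · exact absurd (Reachable.refl _) hz
  · refine absurd (hy.trans (Adj.reachable ?_)) hz
    rw [deleteEdges_adj]
    exact ⟨hzy.symm, by rwa [Set.mem_singleton_iff, Sym2.eq_swap]⟩

theorem IsEdgeCut.le_length (hconn : G.Connected) {S : Set V} {p q : V} (h : G.IsEdgeCut S p q)
    {z x : V} (w : G.Walk z x) (hz : z ∉ S) (hx : x ∈ S) :
    G.dist z p + 1 + G.dist q x ≤ w.length := by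
  induction w with
  | nil => exact absurd hx hz
  | @cons a b c hab w ih =>
    rw [Walk.length_cons]
    by_cases hb : b ∈ S
    · obtain ⟨rfl, rfl⟩ := h.eq_of_adj hz hb hab
      have := dist_le w
      rw [dist_self]
      omega
    · have h1 := ih hb hx
      have h2 := hconn.dist_triangle (u := a) (v := b) (w := p)
      have h3 := dist_eq_one_iff_adj.2 hab
      omega

theorem IsEdgeCut.dist_eq (hconn : G.Connected) {S : Set V} {p q : V} (h : G.IsEdgeCut S p q)
    {z x : V} (hz : z ∉ S) (hx : x ∈ S) : G.dist z x = G.dist z p + 1 + G.dist q x := by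
  obtain ⟨w, hw⟩ := hconn.exists_walk_length_eq_dist z x
  have h1 := h.le_length hconn w hz hx
  have h2 := hconn.dist_triangle (u := z) (v := p) (w := x)
  have h3 := hconn.dist_triangle (u := p) (v := q) (w := x)
  have h4 := dist_eq_one_iff_adj.2 h.adj
  omega

theorem Connected.exists_adj_dist_add_one (hconn : G.Connected) {u v : V} (h : u ≠ v) :
    ∃ y, G.Adj u y ∧ G.dist u v = G.dist y v + 1 := by
  obtain ⟨w, hw⟩ := hconn.exists_walk_length_eq_dist u v
  cases w with
  | nil => exact absurd rfl h
  | @cons _ y _ hy w =>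
    refine ⟨y, hy, ?_⟩
    have h1 := dist_le w
    have h2 := hconn.dist_triangle (u := u) (v := y) (w := v)
    have h3 := dist_eq_one_iff_adj.2 hy
    rw [Walk.length_cons] at hw
    omega

/-! ### Bridge cores, gates and isometry -/

/-- A connected subgraph containing all edges of `G` that are not bridges. -/
structure Subgraph.IsBridgeCore (C : G.Subgraph) : Prop where
  connected : C.Connected
  isBridge : ∀ ⦃p q⦄, G.Adj p q → ¬ C.Adj p q → G.IsBridge s(p, q)

namespace Subgraph.IsBridgeCore

variable {C : G.Subgraph}

theorem exists_isEdgeCut (hC : C.IsBridgeCore) {p q : V} (hadj : G.Adj p q) (h : ¬ C.Adj p q) :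
    ∃ S, G.IsEdgeCut S p q :=
  (hC.isBridge hadj h).exists_isEdgeCut hadj

theorem notMem_of_notMem (hC : C.IsBridgeCore) {S : Set V} {p q : V} (hS : G.IsEdgeCut S p q)
    (hpq : ¬ C.Adj p q) {c c' : V} (hc : c ∈ C.verts) (hc' : c' ∈ C.verts) (h : c ∉ S) :
    c' ∉ S := by
  obtain ⟨w⟩ := hC.connected.preconnected.coe ⟨c, hc⟩ ⟨c', hc'⟩
  have key : ∀ (a b : C.verts) (_ : C.coe.Walk a b), (a : V) ∉ S → (b : V) ∉ S := by
    intro a b w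
    induction w with
    | nil => exact id
    | @cons a b _ hab w ih =>
      intro ha
      refine ih fun hb => hpq ?_
      have hab' : C.Adj a b := hab
      obtain ⟨h1, h2⟩ := hS.eq_of_adj ha hb hab'.adj_sub
      rwa [h1, h2] at hab'
  exact key _ _ w h

/-- A vertex of `S` farthest from `p` is a leaf: a second neighbour would lie across a bridge from
the first and be farther still. -/
theorem exists_leaf_mem [Fintype V] [DecidableRel G.Adj] (hconn : G.Connected)
    (hC : C.IsBridgeCore) {S : Set V} {p q : V} (hS : G.IsEdgeCut S p q)
    (hCS : ∀ c ∈ C.verts, c ∉ S) : ∃ x ∈ S, G.degree x = 1 := by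
  obtain ⟨x, hx, hmax⟩ := Set.exists_max_image S (G.dist p) (Set.toFinite _) ⟨q, hS.right_mem⟩
  refine ⟨x, hx, ?_⟩
  have hpx : p ≠ x := fun h => hS.left_notMem (h ▸ hx)
  have hle : ∀ y, G.Adj x y → G.dist p y ≤ G.dist p x := by
    intro y hy
    by_cases hyS : y ∈ S
    · exact hmax y hyS
    · rw [(hS.eq_of_adj hyS hx hy.symm).1, dist_self]
      exact Nat.zero_le _
  have huniq : ∀ y, G.Adj x y → ∀ y', G.Adj x y' → y = y' := by
    intro y hy y' hy'
    by_contra hne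
    obtain ⟨T, hT⟩ := hC.exists_isEdgeCut hy.symm
      (fun h => hCS x (C.edge_vert h.symm) hx)
    have hpT : p ∉ T := by
      intro hpT
      have h1 := hT.dist_eq hconn hT.left_notMem hpT
      have h2 := hle y hy
      rw [dist_self, dist_comm, G.dist_comm (u := x)] at h1
      omega
    have hy'T : y' ∈ T := by
      by_contra h
      exact hne (hT.eq_of_adj h hT.right_mem hy'.symm).1.symm
    have h1 := hT.dist_eq hconn hpT hy'T
    have h2 := hT.dist_eq hconn hpT hT.right_mem
    have h3 := hle y' hy'
    rw [dist_eq_one_iff_adj.2 hy'] at h1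
    rw [dist_self] at h2
    omega
  obtain ⟨y, hy, -⟩ := hconn.exists_adj_dist_add_one hpx.symm
  exact SimpleGraph.degree_eq_one_iff_existsUnique_adj.2
    ⟨y, hy, fun y' hy' => huniq y' hy' y hy⟩

/-- Every vertex has a gate in the core. -/
theorem exists_gate (hconn : G.Connected) (hC : C.IsBridgeCore) [Finite V] (u : V) :
    ∃ g ∈ C.verts, ∀ c ∈ C.verts, G.dist u c = G.dist u g + G.dist g c := by
  obtain ⟨g, hg, hmin⟩ := Set.exists_min_image C.verts (G.dist u) (Set.toFinite _)
    hC.connected.nonempty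
  refine ⟨g, hg, fun c hc => ?_⟩
  by_cases hug : g = u
  · simp [hug]
  obtain ⟨q, hq, hd⟩ := hconn.exists_adj_dist_add_one hug
  have hqC : q ∉ C.verts := by
    intro h
    have h1 := hmin q h
    rw [dist_comm, G.dist_comm (u := u)] at h1
    omega
  -- The first edge of a geodesic from `g` to `u` leaves the core, so its cut separates `u` from the
  -- whole core.
  have hgq : ¬ C.Adj g q := fun h => hqC (C.edge_vert h.symm)
  obtain ⟨S, hS⟩ := hC.exists_isEdgeCut hq hgq
  have huS : u ∈ S := by
    by_contra h
    have h1 := hS.dist_eq hconn h hS.right_mem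
    rw [dist_self, dist_comm, G.dist_comm (u := u)] at h1
    omega
  have h1 := hS.dist_eq hconn (hC.notMem_of_notMem hS hgq hg hc hS.left_notMem) huS
  have h2 := G.dist_comm (u := u) (v := c)
  have h3 := G.dist_comm (u := u) (v := g)
  have h4 := G.dist_comm (u := c) (v := g)
  omega

/-- The core is isometrically embedded. -/
theorem coe_dist_eq (hconn : G.Connected) (hC : C.IsBridgeCore) (c c' : C.verts) :
    C.coe.dist c c' = G.dist (c : V) c' := by
  apply le_antisymm
  · have key : ∀ (n : ℕ) (c : C.verts), G.dist (c : V) c' = n → C.coe.dist c c' ≤ n := by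
      intro n
      induction n with
      | zero =>
        intro c hn
        have := Subtype.ext (hconn.dist_eq_zero_iff.1 hn)
        simp [this]
      | succ n ih =>
        intro c hn
        have hne : (c : V) ≠ c' := by
          intro h
          rw [h, dist_self] at hn
          omega
        obtain ⟨y, hy, hd⟩ := hconn.exists_adj_dist_add_one hne
        by_cases hcy : C.Adj c y
        · have h1 := ih ⟨y, C.edge_vert hcy.symm⟩ (by simp only; omega)
          have h2 : C.coe.Adj c ⟨y, C.edge_vert hcy.symm⟩ := hcy
          have h3 := dist_eq_one_iff_adj.2 h2
          have h4 := hC.connected.coe.dist_triangle (u := c) (v := ⟨y, C.edge_vert hcy.symm⟩)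
            (w := c')
          omega
        -- A geodesic between core vertices cannot leave the core: past the cut, `y` would be
        -- farther from `c'` than `c` is.
        · obtain ⟨S, hS⟩ := hC.exists_isEdgeCut hy hcy
          have h1 := hS.dist_eq hconn
            (hC.notMem_of_notMem hS hcy c.2 c'.2 hS.left_notMem) hS.right_mem
          have h2 := G.dist_comm (u := c') (v := (c : V))
          have h3 := G.dist_comm (u := c') (v := y)
          rw [dist_self] at h1
          omega
    exact key _ c rfl
  · obtain ⟨w, hw⟩ := hC.connected.coe.exists_walk_length_eq_dist c c'
    rw [← hw, ← Walk.length_map C.hom w]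
    exact dist_le _

/-! ### Leaves as landmarks -/

/-- Beyond a vertex `u` that is off the core or has an edge leaving the core there is a leaf `x`
such that each vertex `z` either reaches `x` through `u` or is reached from the core through `u`. -/
theorem exists_leaf_beyond [Fintype V] [DecidableRel G.Adj] (hconn : G.Connected)
    (hC : C.IsBridgeCore) {u : V} (hu : u ∉ C.verts ∨ ∃ q, G.Adj u q ∧ ¬ C.Adj u q) :
    ∃ x ∈ G.leafSet, ∀ z, G.dist z x = G.dist z u + G.dist u x ∨
      ∀ c ∈ C.verts, G.dist c z = G.dist c u + G.dist u z := by
  by_cases huC : u ∈ C.verts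
  · obtain ⟨q, hq, hCq⟩ := hu.resolve_left (not_not_intro huC)
    obtain ⟨S, hS⟩ := hC.exists_isEdgeCut hq hCq
    have hCS : ∀ c ∈ C.verts, c ∉ S := fun c hc =>
      hC.notMem_of_notMem hS hCq huC hc hS.left_notMem
    obtain ⟨x, hx, hdeg⟩ := hC.exists_leaf_mem hconn hS hCS
    have key : ∀ z ∉ S, ∀ y ∈ S, G.dist z y = G.dist z u + G.dist u y := by
      intro z hz y hy
      have h1 := hS.dist_eq hconn hz hy
      have h2 := hS.dist_eq hconn hS.left_notMem hy
      rw [dist_self] at h2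
      omega
    refine ⟨x, hdeg, fun z => ?_⟩
    by_cases hz : z ∈ S
    · exact Or.inr fun c hc => key c (hCS c hc) z hz
    · exact Or.inl (key z hz x hx)
  · obtain ⟨g, hg⟩ := hC.connected.nonempty
    have hgu : u ≠ g := fun h => huC (h ▸ hg)
    obtain ⟨p, hp, hd⟩ := hconn.exists_adj_dist_add_one hgu
    have hCp : ¬ C.Adj p u := fun h => huC (C.edge_vert h.symm)
    obtain ⟨S, hS⟩ := hC.exists_isEdgeCut hp.symm hCp
    have hgS : g ∉ S := by
      intro hgS
      have h1 := hS.dist_eq hconn hS.left_notMem hgS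
      rw [dist_self] at h1
      omega
    have hCS : ∀ c ∈ C.verts, c ∉ S := fun c hc => hC.notMem_of_notMem hS hCp hg hc hgS
    obtain ⟨x, hx, hdeg⟩ := hC.exists_leaf_mem hconn hS hCS
    have key : ∀ z ∉ S, ∀ y ∈ S, G.dist z y = G.dist z u + G.dist u y := by
      intro z hz y hy
      have h1 := hS.dist_eq hconn hz hy
      have h2 := hS.dist_eq hconn hz hS.right_mem
      rw [dist_self] at h2
      omega
    refine ⟨x, hdeg, fun z => ?_⟩
    by_cases hz : z ∈ S
    · exact Or.inr fun c hc => key c (hCS c hc) z hz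
    · exact Or.inl (key z hz x hx)

/-- A vertex `w` of the core with an edge leaving the core, other than the gates of `u` and `v`,
can be replaced by a leaf as a landmark for `u` and `v`. -/
theorem exists_leaf_sub_eq [Fintype V] [DecidableRel G.Adj] (hconn : G.Connected)
    (hC : C.IsBridgeCore) {u v g k w : V} (hgC : g ∈ C.verts) (hkC : k ∈ C.verts)
    (hg : ∀ c ∈ C.verts, G.dist u c = G.dist u g + G.dist g c)
    (hk : ∀ c ∈ C.verts, G.dist v c = G.dist v k + G.dist k c)
    (hwC : w ∈ C.verts) (hw : ∃ q, G.Adj w q ∧ ¬ C.Adj w q) (hwg : w ≠ g) (hwk : w ≠ k) :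
    ∃ x ∈ G.leafSet, (G.dist v x : ℤ) - G.dist u x = (G.dist v w : ℤ) - G.dist u w := by
  obtain ⟨x, hx, hz⟩ := hC.exists_leaf_beyond hconn (Or.inr hw)
  have aux : ∀ {z m : V}, m ∈ C.verts → (∀ c ∈ C.verts, G.dist z c = G.dist z m + G.dist m c) →
      w ≠ m → G.dist z x = G.dist z w + G.dist w x := by
    intro z m hm hzm hne
    rcases hz z with h | h
    · exact h
    · have h1 := h m hm
      have h2 := hzm w hwC
      have h3 := G.dist_comm (u := z) (v := m)
      have h4 := G.dist_comm (u := z) (v := w)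
      have h5 := G.dist_comm (u := w) (v := m)
      have h6 := hconn.pos_dist_of_ne hne
      omega
  have h1 := aux hgC hg hwg
  have h2 := aux hkC hk hwk
  exact ⟨x, hx, by omega⟩

/-- For vertices with a common gate some leaf attains the maximal difference of distances. -/
theorem exists_leaf_sub_eq_dist [Fintype V] [DecidableRel G.Adj] (hconn : G.Connected)
    (hC : C.IsBridgeCore) {u v g w : V} (hgC : g ∈ C.verts)
    (hg : ∀ c ∈ C.verts, G.dist u c = G.dist u g + G.dist g c)
    (hk : ∀ c ∈ C.verts, G.dist v c = G.dist v g + G.dist g c)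
    (hwC : w ∈ C.verts) (hw : ∃ q, G.Adj w q ∧ ¬ C.Adj w q) (hwg : w ≠ g) :
    ∃ x ∈ G.leafSet, (G.dist v x : ℤ) - G.dist u x = G.dist v u := by
  have key : G.dist g v = G.dist g u + G.dist u v →
      ∃ x ∈ G.leafSet, (G.dist v x : ℤ) - G.dist u x = G.dist v u := by
    intro h
    obtain ⟨x, hx, hd⟩ := hC.exists_leaf_sub_eq hconn hgC hgC hg hk hwC hw hwg hwg
    have h1 := hg w hwC
    have h2 := hk w hwC
    have h3 := G.dist_comm (u := g) (v := u)
    have h4 := G.dist_comm (u := g) (v := v)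
    have h5 := G.dist_comm (u := u) (v := v)
    exact ⟨x, hx, by omega⟩
  by_cases hu : u ∈ C.verts
  · have h1 := hg u hu
    rw [dist_self] at h1
    have h2 : u = g := hconn.dist_eq_zero_iff.1 (by omega)
    exact key (by simp [h2])
  · obtain ⟨x, hx, hz⟩ := hC.exists_leaf_beyond hconn (Or.inl hu)
    rcases hz v with h | h
    · exact ⟨x, hx, by omega⟩
    · exact key (h g hgC)

/-- For vertices with different gates, the first one not being an unbranched vertex of the core,
some leaf attains the maximal difference of distances. -/
theorem exists_leaf_sub_eq_dist_of_ne [Fintype V] [DecidableRel G.Adj] (hconn : G.Connected)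
    (hC : C.IsBridgeCore) {u v g k : V} (hgC : g ∈ C.verts) (hkC : k ∈ C.verts)
    (hg : ∀ c ∈ C.verts, G.dist u c = G.dist u g + G.dist g c)
    (hk : ∀ c ∈ C.verts, G.dist v c = G.dist v k + G.dist k c) (hne : g ≠ k)
    (hu : u ∉ C.verts ∨ ∃ q, G.Adj u q ∧ ¬ C.Adj u q) :
    ∃ x ∈ G.leafSet, (G.dist v x : ℤ) - G.dist u x = G.dist v u := by
  obtain ⟨x, hx, hz⟩ := hC.exists_leaf_beyond hconn hu
  rcases hz v with h | h
  · exact ⟨x, hx, by omega⟩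
  -- Impossible: `g` would be closer to `v` than its own gate `k`.
  · have h1 := h g hgC
    have h2 := h k hkC
    have h3 := hk g hgC
    have h4 := hg k hkC
    have h5 := hconn.pos_dist_of_ne hne
    have h6 := G.dist_comm (u := g) (v := u)
    have h7 := G.dist_comm (u := g) (v := v)
    have h8 := G.dist_comm (u := k) (v := u)
    have h9 := G.dist_comm (u := k) (v := v)
    have h10 := G.dist_comm (u := g) (v := k)
    omega

/-- If `v` is an vertex of the core outside the landmark set `W`, the leaves doubly resolve `u` and
`v` when their gates differ. -/
theorem exists_leaf_sub_ne_of_mem [Fintype V] [DecidableRel G.Adj] (hconn : G.Connected)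
    (hC : C.IsBridgeCore) {W : Set V} (hWC : W ⊆ C.verts)
    (hWq : ∀ w ∈ W, ∃ q, G.Adj w q ∧ ¬ C.Adj w q)
    (hW : ∀ u ∈ C.verts, ∀ v ∈ C.verts, u ≠ v → ∃ x ∈ W, ∃ y ∈ W, G.DoublyResolves x y u v)
    {u v g : V} (hgC : g ∈ C.verts) (hvC : v ∈ C.verts)
    (hg : ∀ c ∈ C.verts, G.dist u c = G.dist u g + G.dist g c) (hne : g ≠ v) (hvW : v ∉ W) :
    ∃ x ∈ G.leafSet, ∃ y ∈ G.leafSet, G.DoublyResolves x y u v := by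
  by_contra! hcon
  have hconst : ∀ x ∈ G.leafSet, ∀ y ∈ G.leafSet,
      (G.dist v x : ℤ) - G.dist u x = (G.dist v y : ℤ) - G.dist u y :=
    fun x hx y hy => not_not.1 (hcon x hx y hy)
  have hv : ∀ c ∈ C.verts, G.dist v c = G.dist v v + G.dist v c := by simp
  have hleaf : ∀ w ∈ W, w ≠ g → ∃ x ∈ G.leafSet,
      (G.dist v x : ℤ) - G.dist u x = (G.dist v w : ℤ) - G.dist u w := fun w hw hwg =>
    hC.exists_leaf_sub_eq hconn hgC hvC hg hv (hWC hw) (hWq w hw) hwg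
      (fun h => hvW (h ▸ hw))
  obtain ⟨x, hx, y, hy, hxy⟩ := hW g hgC v hvC hne
  unfold DoublyResolves at hxy
  -- If `g` is in `W`, a leaf beyond `u` gives the maximal difference. Constancy passes it on to
  -- `w`, so `g` lies between `v` and `w`, and the pair `g`, `w` cannot resolve `g` and `v`.
  have hbig : ∀ w ∈ W, g ∈ W → w ≠ g → G.dist v w = G.dist v g + G.dist g w := by
    intro w hw hgW hwg
    have hu : u ∉ C.verts ∨ ∃ q, G.Adj u q ∧ ¬ C.Adj u q := by
      by_cases hu : u ∈ C.verts
      · have h1 := hg u hu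
        rw [dist_self] at h1
        have h2 : u = g := hconn.dist_eq_zero_iff.1 (by omega)
        exact Or.inr (h2 ▸ hWq g hgW)
      · exact Or.inl hu
    obtain ⟨l, hl, hl'⟩ := hC.exists_leaf_sub_eq_dist_of_ne hconn hgC hvC hg hv hne hu
    obtain ⟨m, hm, hm'⟩ := hleaf w hw hwg
    have h1 := hconst l hl m hm
    have h2 := hg v hvC
    have h3 := hg w (hWC hw)
    have h4 := hconn.dist_triangle (u := v) (v := g) (w := w)
    have h5 := G.dist_comm (u := g) (v := v)
    have h6 := G.dist_comm (u := u) (v := v)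
    omega
  by_cases hxg : x = g
  · by_cases hyg : y = g
    · exact hxy (by rw [hxg, hyg])
    · have h1 := hbig y hy (hxg ▸ hx) hyg
      rw [hxg, dist_self] at hxy
      omega
  · by_cases hyg : y = g
    · have h1 := hbig x hx (hyg ▸ hy) hxg
      rw [hyg, dist_self] at hxy
      omega
    · obtain ⟨l, hl, hl'⟩ := hleaf x hx hxg
      obtain ⟨m, hm, hm'⟩ := hleaf y hy hyg
      have h1 := hconst l hl m hm
      have h2 := hg x (hWC hx)
      have h3 := hg y (hWC hy)
      omega

theorem isDoublyResolvingSet_leafSet [Fintype V] [DecidableRel G.Adj] (hconn : G.Connected)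
    (hC : C.IsBridgeCore) {W : Set V} (hWC : W ⊆ C.verts) (hWnt : W.Nontrivial)
    (hWq : ∀ w ∈ W, ∃ q, G.Adj w q ∧ ¬ C.Adj w q)
    (hW : ∀ u ∈ C.verts, ∀ v ∈ C.verts, u ≠ v → ∃ x ∈ W, ∃ y ∈ W, G.DoublyResolves x y u v) :
    G.IsDoublyResolvingSet G.leafSet := by
  intro u v huv
  obtain ⟨g, hgC, hg⟩ := hC.exists_gate hconn u
  obtain ⟨k, hkC, hk⟩ := hC.exists_gate hconn v
  have hpos := hconn.pos_dist_of_ne huv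
  have hcomm := G.dist_comm (u := u) (v := v)
  -- The two extremes `d(u,v)` and `-d(u,v)` differ because `u ≠ v`.
  have hext : (∃ x ∈ G.leafSet, (G.dist v x : ℤ) - G.dist u x = G.dist v u) →
      (∃ x ∈ G.leafSet, (G.dist u x : ℤ) - G.dist v x = G.dist u v) →
      ∃ x ∈ G.leafSet, ∃ y ∈ G.leafSet, G.DoublyResolves x y u v := by
    rintro ⟨x, hx, hx'⟩ ⟨y, hy, hy'⟩
    refine ⟨x, hx, y, hy, ?_⟩
    unfold DoublyResolves
    omega
  by_cases hgk : g = k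
  · subst hgk
    obtain ⟨w, hw, hwg⟩ := hWnt.exists_ne g
    exact hext (hC.exists_leaf_sub_eq_dist hconn hgC hg hk (hWC hw) (hWq w hw) hwg)
      (hC.exists_leaf_sub_eq_dist hconn hgC hk hg (hWC hw) (hWq w hw) hwg)
  have hgate : ∀ {z m : V}, z ∈ C.verts →
      (∀ c ∈ C.verts, G.dist z c = G.dist z m + G.dist m c) → z = m := by
    intro z m hz hzm
    have h1 := hzm z hz
    rw [dist_self] at h1
    exact hconn.dist_eq_zero_iff.1 (by omega)
  by_cases hv : v ∈ C.verts ∧ v ∉ W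
  · have hvk := hgate hv.1 hk
    exact hC.exists_leaf_sub_ne_of_mem hconn hWC hWq hW hgC hv.1 hg (hvk ▸ hgk) hv.2
  by_cases hu : u ∈ C.verts ∧ u ∉ W
  · have hug := hgate hu.1 hg
    obtain ⟨x, hx, y, hy, hxy⟩ := hC.exists_leaf_sub_ne_of_mem hconn hWC hWq hW hkC hu.1 hk
      (hug ▸ Ne.symm hgk) hu.2
    refine ⟨x, hx, y, hy, ?_⟩
    unfold DoublyResolves at hxy ⊢
    omega
  have hbranch : ∀ {z : V}, ¬ (z ∈ C.verts ∧ z ∉ W) →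
      z ∉ C.verts ∨ ∃ q, G.Adj z q ∧ ¬ C.Adj z q := by
    intro z hz
    by_cases h : z ∈ C.verts
    · exact Or.inr (hWq z (by tauto))
    · exact Or.inl h
  exact hext (hC.exists_leaf_sub_eq_dist_of_ne hconn hgC hkC hg hk hgk (hbranch hu))
    (hC.exists_leaf_sub_eq_dist_of_ne hconn hkC hgC hk hg (Ne.symm hgk) (hbranch hv))

end Subgraph.IsBridgeCore

/-! ### Lower bound: leaves are forced -/

/-- Every doubly resolving set of a connected graph contains all leaves. -/
theorem IsDoublyResolvingSet.leafSet_subset [G.LocallyFinite] (hconn : G.Connected) {W : Set V}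
    (hW : G.IsDoublyResolvingSet W) : G.leafSet ⊆ W := by
  intro l hl
  obtain ⟨p, hp, huniq⟩ := degree_eq_one_iff_existsUnique_adj.1 hl
  have hd : ∀ x, x ≠ l → G.dist l x = G.dist p x + 1 := by
    intro x hx
    obtain ⟨y, hy, h⟩ := hconn.exists_adj_dist_add_one hx.symm
    rwa [huniq y hy] at h
  obtain ⟨x, hx, y, hy, hxy⟩ := hW p l (G.ne_of_adj hp).symm
  by_contra hlW
  have h1 := hd x (fun h => hlW (h ▸ hx))
  have h2 := hd y (fun h => hlW (h ▸ hy))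
  unfold DoublyResolves at hxy
  omega

/-! ### The cycle of a unicyclic graph -/

theorem IsUnicyclic.isCycleSubgraph_cycle (hG : G.IsUnicyclic) : hG.cycle.IsCycleSubgraph :=
  hG.choose_spec.1

/-- An edge off the only cycle lies on no cycle, hence is a bridge. -/
theorem IsUnicyclic.isBridgeCore_cycle (hG : G.IsUnicyclic) : hG.cycle.IsBridgeCore := by
  obtain ⟨a, w, hw, hwC⟩ := hG.isCycleSubgraph_cycle
  refine ⟨hwC ▸ w.toSubgraph_connected, fun p q hadj h => ?_⟩
  rw [isBridge_iff_forall_cycle_notMem ((mem_edgeSet G).2 hadj)]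
  intro b c hc hmem
  have hcC : c.toSubgraph = hG.cycle := hG.choose_spec.2 _ ⟨b, c, hc, rfl⟩
  apply h
  rw [← hcC, ← Subgraph.mem_edgeSet, Walk.mem_edges_toSubgraph]
  exact hmem

theorem IsUnicyclic.ncard_neighborSet_cycle (hG : G.IsUnicyclic) {v : V}
    (hv : v ∈ hG.cycle.verts) : (hG.cycle.neighborSet v).ncard = 2 := by
  obtain ⟨a, w, hw, hwC⟩ := hG.isCycleSubgraph_cycle
  rw [← hwC] at hv ⊢
  exact hw.ncard_neighborSet_toSubgraph_eq_two (w.mem_verts_toSubgraph.1 hv)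

theorem IsUnicyclic.exists_adj_not_cycle_adj [Fintype V] [DecidableRel G.Adj]
    (hG : G.IsUnicyclic) {v : V} (hv : v ∈ hG.cycle.verts) (hdeg : 3 ≤ G.degree v) :
    ∃ q, G.Adj v q ∧ ¬ hG.cycle.Adj v q := by
  by_contra! h
  have h1 : G.neighborSet v ⊆ hG.cycle.neighborSet v := h
  have h2 := Set.ncard_le_ncard h1 (Set.toFinite _)
  rw [hG.ncard_neighborSet_cycle hv, Set.ncard_eq_toFinset_card'] at h2
  rw [← card_neighborFinset_eq_degree, neighborFinset] at hdeg
  omega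

theorem IsUnicyclic.exists_ne_mem_cycle (hG : G.IsUnicyclic) :
    ∃ u ∈ hG.cycle.verts, ∃ v ∈ hG.cycle.verts, u ≠ v := by
  obtain ⟨u, hu⟩ := hG.isBridgeCore_cycle.connected.nonempty
  have h := hG.ncard_neighborSet_cycle hu
  obtain ⟨v, hv⟩ := Set.nonempty_of_ncard_ne_zero (by omega : (hG.cycle.neighborSet u).ncard ≠ 0)
  have hv' : hG.cycle.Adj u v := hv
  exact ⟨u, hu, v, hG.cycle.edge_vert hv'.symm, hv'.ne⟩

end SimpleGraph

open SimpleGraph in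
theorem mainTheorem4 {V : Type*} [Fintype V] (G : SimpleGraph V) [DecidableRel G.Adj]
    (hconn : G.Connected) (hG : G.IsUnicyclic)
    (W : Set hG.cycle.verts) (hW : hG.cycle.coe.IsDoublyResolvingSet W)
    (hdeg : ∀ w ∈ W, 3 ≤ G.degree (w : V)) :
    G.IsDoublyBasis G.leafSet := by
  have hC := hG.isBridgeCore_cycle
  have hres : ∀ u ∈ hG.cycle.verts, ∀ v ∈ hG.cycle.verts, u ≠ v →
      ∃ x ∈ Subtype.val '' W, ∃ y ∈ Subtype.val '' W, G.DoublyResolves x y u v := by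
    intro u hu v hv huv
    obtain ⟨x, hx, y, hy, hxy⟩ := hW ⟨u, hu⟩ ⟨v, hv⟩ (fun h => huv (congrArg Subtype.val h))
    refine ⟨x, ⟨x, hx, rfl⟩, y, ⟨y, hy, rfl⟩, ?_⟩
    simpa only [DoublyResolves, hC.coe_dist_eq hconn] using hxy
  -- A single landmark resolves nothing; a second one is needed to avoid a common gate.
  have hnt : (Subtype.val '' W).Nontrivial := by
    obtain ⟨u, hu, v, hv, huv⟩ := hG.exists_ne_mem_cycle
    obtain ⟨x, hx, y, hy, hxy⟩ := hres u hu v hv huv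
    exact ⟨x, hx, y, hy, fun h => hxy (by rw [h])⟩
  refine ⟨hC.isDoublyResolvingSet_leafSet hconn ?_ hnt ?_ hres,
    fun W' hW' => Set.encard_le_encard (hW'.leafSet_subset hconn)⟩
  · rintro _ ⟨w, -, rfl⟩
    exact w.2
  · rintro _ ⟨w, hw, rfl⟩
    exact hG.exists_adj_not_cycle_adj w.2 (hdeg w hw)
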